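/- **Setting.** Consider a finite-horizon MDP with horizon $H\ge 1$, observations $o_t\in\mathcal O$, actions $a_t\in\mathcal A$ and rewards $r_t\in[0,1]$. A state $s_t\in\mathcal S$ is any fixed function of the observations, actions and rewards before step $t$ together with $o_t$. A policy $\pi(a|s)$ chooses $a_t\sim\pi(\cdot|s_t)$. For a trajectory $\tau=(o_1,a_1,r_1,\dots,o_H,a_H,r_H)$ let $g(\tau)=\sum_{t=1}^H r_t$, and let $J(\pi)=\mathbb E_{\tau\sim\pi}[g(\tau)]$. Let $P_\pi$ be the joint law of $(s_t,a_t,g(\tau))$, where $\tau\sim\pi$ and $t$ is independent of $\tau$ and uniform on $\{1,\dots,H\}$; thus $P_\pi(s)$ is the state occupancy averaged over the $H$ steps. (The spaces are measurable spaces, $\mathcal A$ is standard Borel, and conditional laws are regular conditional distributions.) Let $\beta$ be a behavior policy and $f:\mathcal S\to\mathbb R$ a conditioning function. Put $\pi_f^{\mathrm{RCSL}}(a|s)=P_\beta(a|s,f(s))$, and for a return-conditioned policy $\pi(a|s,g)$ put $\pi_f(a|s)=\pi(a|s,f(s))$ and $$L(\pi)=\mathbb E_{s\sim P_\beta}\,\mathbb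 E_{g\sim P_\beta(\cdot|s)}\big[D_{\mathrm{KL}}(P_\beta(\cdot|s,g)\,\|\,\pi(\cdot|s,g))\big].$$ **Assumptions.** There are constants $C_f$, $\alpha_f>0$, $c$, $\epsilon_{approx}\ge 0$ such that: 1. (Bounded occupancy mismatch) $P_{\pi_f^{\mathrm{RCSL}}}(s)/P_\beta(s)\le C_f$ for all $s$, i.e. $P_{\pi_f^{\mathrm{RCSL}}}(B)\le C_f\,P_\beta(B)$ for all measurable sets $B$ of states. 2. (Return coverage) $P_\beta(g=f(s)\,|\,s)\ge\alpha_f$ for $P_\beta$-almost all $s$. 3. (Finite class) $\Pi$ is a finite set of return-conditioned policies, given by likelihoods $\pi(a|s,g)$, which are probability densities in $a$ with respect to a fixed $\sigma$-finite measure on $\mathcal A$ (e.g. counting measure). 4. (Bounded log-likelihoods) For all $\pi\in\Pi$, $\pi(a|s,g)>0$ and $|\log\pi(a|s,g)-\log\pi(a'|s',g')|\le c$ for all $(a,s,g,a',s',g')$. 5. (Approximation error) $\min_{\pi\in\Pi}L(\pi)\le\epsilon_{approx}$. **Conclusion.** There is a universal constant $K>0$ such that, in every such setting, for all $N\ge1$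 and $\delta\in(0,1)$: if $\mathcal D$ consists of $N$ independent trajectories generated by $\beta$, then with probability at least $1-\delta$ every minimizer $\hat\pi\in\Pi$ of the empirical negative log-likelihood $\hat L(\pi)=-\sum_{\tau\in\mathcal D}\sum_{t=1}^H\log\pi(a_t|s_t,g(\tau))$ satisfies $$J(\pi_f^{\mathrm{RCSL}})-J(\hat\pi_f)\le K\,\frac{C_f}{\alpha_f}H^2\left(\sqrt c\left(\frac{\log(|\Pi|/\delta)}{N}\right)^{1/4}+\sqrt{\epsilon_{approx}}\right).$$ -/

import Mathlib

open MeasureTheory ProbabilityTheory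

noncomputable section

namespace RCSL

/-- One step of a trajectory: observation, action, and reward in `[0, 1]`. -/
abbrev Step (O A : Type*) := O × A × unitInterval

/-- A trajectory of `n` steps, `(o_1, a_1, r_1, …, o_n, a_n, r_n)`; the steps are indexed from 0. -/
abbrev Traj (O A : Type*) (n : ℕ) := Fin n → Step O A

/-- What is known when the action of step `t` is chosen: the `t` earlier steps together with the
current observation. -/
abbrev Hist (O A : Type*) (t : ℕ) := Traj O A t × O

/-- A finite-horizon Markov decision process with rewards in `[0, 1]`: a law of the initial
observation and, at each step `t`, a joint law of the reward and the next observation given the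
current observation and action. (The transitions may, but need not, depend on `t`.) -/
structure MDP (O A : Type*) [MeasurableSpace O] [MeasurableSpace A] where
  init : Measure O
  init_prob : IsProbabilityMeasure init
  trans : ℕ → Kernel (O × A) (unitInterval × O)
  trans_markov : ∀ t, IsMarkovKernel (trans t)

attribute [instance] MDP.init_prob MDP.trans_markov

/-- A state representation: the state at step `t` is an arbitrary (measurable) function of the
history of observations, actions and rewards before step `t` and of the current observation. -/
structure StateRep (O A S : Type*) [MeasurableSpace O] [MeasurableSpace A]
    [MeasurableSpace S] where
  toState : (t : ℕ) → Hist O A t → S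
  measurable_toState : ∀ t, Measurable (toState t)

section Laws

variable {O A S : Type*} [MeasurableSpace O] [MeasurableSpace A] [MeasurableSpace S]

/-- Append the step `(o, a, r)` to the past and make `o'` the current observation. -/
def extend (t : ℕ) (x : (Hist O A t × A) × (unitInterval × O)) : Hist O A (t + 1) :=
  (Fin.snoc (α := fun _ => Step O A) x.1.1.1 (x.1.1.2, x.1.2, x.2.1), x.2.2)

theorem measurable_extend (t : ℕ) : Measurable (extend (O := O) (A := A) t) := by
  refine Measurable.prodMk ?_ (by fun_prop)
  refine measurable_pi_iff.2 fun i => ?_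
  refine Fin.lastCases ?_ (fun j => ?_) i
  · simp only [Fin.snoc_last]; fun_prop
  · simp only [Fin.snoc_castSucc]; fun_prop

/-- The law of the history at step `t` when the policy `π(· | s)` interacts with the MDP:
`o_0 ∼ init`, then `a_t ∼ π(· | s_t)` and `(r_t, o_{t+1}) ∼ trans t (o_t, a_t)`. -/
def histLaw (M : MDP O A) (φ : StateRep O A S) (π : Kernel S A) : (t : ℕ) → Measure (Hist O A t)
  | 0 => M.init.map fun o => (Fin.elim0, o)
  | t + 1 =>
    ((histLaw M φ π t ⊗ₘ π.comap (φ.toState t) (φ.measurable_toState t)) ⊗ₘ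
      (M.trans t).comap (fun x : Hist O A t × A => (x.1.2, x.2)) (by fun_prop)).map (extend t)

instance histLaw_prob (M : MDP O A) (φ : StateRep O A S) (π : Kernel S A) [IsMarkovKernel π]
    (t : ℕ) : IsProbabilityMeasure (histLaw M φ π t) := by
  induction t with
  | zero => exact Measure.isProbabilityMeasure_map (by fun_prop)
  | succ t ih => exact Measure.isProbabilityMeasure_map (measurable_extend t).aemeasurable

/-- The law of a trajectory of `H` steps under the policy `π`. -/
def trajLaw (M : MDP O A) (φ : StateRep O A S) (H : ℕ) (π : Kernel S A) :
    Measure (Traj O A H) :=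
  (histLaw M φ π H).map Prod.fst

instance trajLaw_prob (M : MDP O A) (φ : StateRep O A S) (H : ℕ) (π : Kernel S A)
    [IsMarkovKernel π] : IsProbabilityMeasure (trajLaw M φ H π) :=
  Measure.isProbabilityMeasure_map measurable_fst.aemeasurable

/-- The return `g(τ)` of a trajectory: the sum of all its rewards. -/
def ret {H : ℕ} (τ : Traj O A H) : ℝ := ∑ t, ((τ t).2.2 : ℝ)

/-- The action at step `t` of a trajectory. -/
def actionAt {H : ℕ} (τ : Traj O A H) (t : Fin H) : A := (τ t).2.1

/-- The state at step `t` of a trajectory. -/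
def stateAt (φ : StateRep O A S) {H : ℕ} (τ : Traj O A H) (t : Fin H) : S :=
  φ.toState t (fun i => τ (Fin.castLE t.2.le i), (τ t).1)

/-- The expected return `J(π)`. -/
def J (M : MDP O A) (φ : StateRep O A S) (H : ℕ) (π : Kernel S A) : ℝ :=
  ∫ τ, ret τ ∂(trajLaw M φ H π)

/-- The law of a trajectory under `π` together with an independent uniformly random step.
`P_π`, as a joint law of a generic state, action and return, is the image of this law. -/
def stepLaw (M : MDP O A) (φ : StateRep O A S) (H : ℕ) (π : Kernel S A) :
    Measure (Traj O A H × Fin H) :=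
  (trajLaw M φ H π).prod (uniformOn Set.univ)

instance stepLaw_finite (M : MDP O A) (φ : StateRep O A S) (H : ℕ) (π : Kernel S A)
    [IsMarkovKernel π] : IsFiniteMeasure (stepLaw M φ H π) := by
  unfold stepLaw; infer_instance

/-- The state occupancy law `P_π(s)`: the average over the `H` steps of the laws of the state. -/
def stateLaw (M : MDP O A) (φ : StateRep O A S) (H : ℕ) (π : Kernel S A) : Measure S :=
  (stepLaw M φ H π).map fun x => stateAt φ x.1 x.2

/-- The conditional law `P_β(g | s)` of the return of the trajectory given the state. -/
def returnGivenState (M : MDP O A) (φ : StateRep O A S) (H : ℕ) (β : Kernel S A)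
    [IsMarkovKernel β] : Kernel S ℝ :=
  condDistrib (fun x => ret x.1) (fun x => stateAt φ x.1 x.2) (stepLaw M φ H β)

/-- The conditional law `P_β(a | s, g)` of the action given the state and the return. -/
def actionGivenStateReturn [StandardBorelSpace A] [Nonempty A] (M : MDP O A)
    (φ : StateRep O A S) (H : ℕ) (β : Kernel S A) [IsMarkovKernel β] : Kernel (S × ℝ) A :=
  condDistrib (fun x => actionAt x.1 x.2) (fun x => (stateAt φ x.1 x.2, ret x.1))
    (stepLaw M φ H β)

/-- The test-time policy `π_f(a | s) = π(a | s, f(s))` of a return-conditioned policy `π`. -/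
def conditionOn (π : Kernel (S × ℝ) A) (f : S → ℝ) (hf : Measurable f) : Kernel S A :=
  π.comap (fun s => (s, f s)) (measurable_id.prodMk hf)

/-- The policy `π_f^RCSL(a | s) = P_β(a | s, f(s))`. -/
def rcslPolicy [StandardBorelSpace A] [Nonempty A] (M : MDP O A) (φ : StateRep O A S) (H : ℕ)
    (β : Kernel S A) [IsMarkovKernel β] (f : S → ℝ) (hf : Measurable f) : Kernel S A :=
  conditionOn (actionGivenStateReturn M φ H β) f hf

end Laws

/-- A return-conditioned policy `π(a | s, g)`, given by its likelihood: a probability density with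
respect to the reference measure `ν` on actions (the counting measure for discrete actions). -/
structure RCPolicy (S : Type*) {A : Type*} [MeasurableSpace S] [MeasurableSpace A]
    (ν : Measure A) where
  lik : S → ℝ → A → ℝ
  lik_nonneg : ∀ s g a, 0 ≤ lik s g a
  measurable_lik : Measurable fun x : (S × ℝ) × A => lik x.1.1 x.1.2 x.2
  lintegral_lik : ∀ s g, ∫⁻ a, ENNReal.ofReal (lik s g a) ∂ν = 1

section Policies

variable {O A S : Type*} [MeasurableSpace O] [MeasurableSpace A] [MeasurableSpace S]
  {ν : Measure A}

/-- The probability kernel `(s, g) ↦ π(· | s, g)` with the given density. -/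
def RCPolicy.toKernel [SFinite ν] (π : RCPolicy S ν) : Kernel (S × ℝ) A :=
  (Kernel.const (S × ℝ) ν).withDensity fun x a => ENNReal.ofReal (π.lik x.1 x.2 a)

instance RCPolicy.toKernel_markov [SFinite ν] (π : RCPolicy S ν) : IsMarkovKernel π.toKernel :=
  ⟨fun x => ⟨by
    rw [RCPolicy.toKernel, Kernel.withDensity_apply' _ (by
      simpa [Function.uncurry_def] using π.measurable_lik.ennreal_ofReal)]
    simpa using π.lintegral_lik x.1 x.2⟩⟩

/-- The expected loss `L(π) = E_{s ∼ P_β} E_{g ∼ P_β(· | s)} KL(P_β(· | s, g) ‖ π(· | s, g))`. -/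
def loss [StandardBorelSpace A] [Nonempty A] [SFinite ν] (M : MDP O A) (φ : StateRep O A S)
    (H : ℕ) (β : Kernel S A) [IsMarkovKernel β] (π : RCPolicy S ν) : ENNReal :=
  ∫⁻ x, InformationTheory.klDiv (actionGivenStateReturn M φ H β x) (π.toKernel x)
    ∂(stateLaw M φ H β ⊗ₘ returnGivenState M φ H β)

/-- The empirical negative log-likelihood of `π` on a dataset of `N` trajectories. -/
def empLoss (φ : StateRep O A S) {H N : ℕ} (D : Fin N → Traj O A H) (π : RCPolicy S ν) : ℝ :=
  -∑ i, ∑ t, Real.log (π.lik (stateAt φ (D i) t) (ret (D i)) (actionAt (D i) t))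

/-- `π` minimizes the empirical negative log-likelihood over the class `P`. -/
def IsEmpMinimizer (φ : StateRep O A S) {H N : ℕ} (D : Fin N → Traj O A H)
    (P : Finset (RCPolicy S ν)) (π : RCPolicy S ν) : Prop :=
  π ∈ P ∧ ∀ π' ∈ P, empLoss φ D π ≤ empLoss φ D π'

end Policies

end RCSL

end

/-! The proof combines a control estimate with a statistical one.

Control. Replacing `π_f^RCSL` by `π_f` at a single step costs at most `H` times the discrepancy of
the two action laws at the current state. Summed over the steps, this is `H²` times the mean
discrepancy under the occupancy of `π_f^RCSL` (`ofReal_J_le`). The occupancy bound moves that mean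
to `P_β` at the price of `C`, and return coverage replaces the return `f(s)` by a random `g` at the
price of `1/α` (`lintegral_conditioned_le`). Pinsker's inequality in the linear form `2l + KL/(2l)`
bounds the discrepancy, so only the mean divergence `L(π)` enters; optimizing `l` gives `2√L(π)`
(`J_rcslPolicy_le`).

Statistics. Fix `π₀` in the class with loss at most `ε`. The excess loss of `π` over `π₀` is at most
the mean of `log(π₀/π)` under `β` plus `ε - L(π₀)`: the unknown action law cancels (`loss_le`). For
an empirical minimizer the empirical mean of this log-ratio is nonpositive, so Hoeffding's
inequality over independent trajectories and a union bound make its true mean at most of order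
`c√(log(|Π|/δ)/N)`. The square root in the control estimate turns this into the fourth root. -/

/-! ### Kullback-Leibler divergence -/

-- The Hellinger bound `(√x - 1)² ≤ klFun x` combined with `x - 1 = (√x - 1)(√x + 1)`, the weighted
-- AM-GM inequality and `(√x + 1)² ≤ 2(x + 1)`. Applied to a density `x = dμ/dν`, it yields the
-- linear Pinsker bound.
open InformationTheory in
theorem le_one_add_klFun {x l : ℝ} (hx : 0 ≤ x) (hl : 0 < l) :
    x ≤ 1 + (l * (x + 1) + klFun x / (2 * l)) := by
  have hell : (√x - 1) ^ 2 ≤ klFun x := by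
    rcases hx.eq_or_lt with rfl | hx
    · simp [klFun_zero]
    have hy : 0 < √x := Real.sqrt_pos.2 hx
    have h1 := Real.one_sub_inv_le_log_of_pos hy
    have h2 : Real.log x = 2 * Real.log √x := by
      rw [Real.log_sqrt hx.le]; ring
    have h3 : √x ^ 2 = x := Real.sq_sqrt hx.le
    have h4 : √x ^ 2 * (√x)⁻¹ = √x := by field_simp
    rw [klFun_apply, h2]
    have h5 : √x ^ 2 * (1 - (√x)⁻¹) ≤ √x ^ 2 * Real.log √x := by gcongr
    rw [mul_sub, h4, mul_one, h3] at h5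
    nlinarith
  have h3 : √x ^ 2 = x := Real.sq_sqrt hx
  have h6 : √x ^ 2 - 1 ≤ l * (√x ^ 2 + 1) + (√x - 1) ^ 2 / (2 * l) := by
    have : l * (√x ^ 2 + 1) + (√x - 1) ^ 2 / (2 * l) - (√x ^ 2 - 1) =
        ((√x - 1 - l * (√x + 1)) ^ 2 + l ^ 2 * (√x - 1) ^ 2) / (2 * l) := by
      field_simp; ring
    have : 0 ≤ ((√x - 1 - l * (√x + 1)) ^ 2 + l ^ 2 * (√x - 1) ^ 2) / (2 * l) := by positivity
    linarith
  rw [h3] at h6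
  have h7 : (√x - 1) ^ 2 / (2 * l) ≤ klFun x / (2 * l) := by gcongr
  linarith

open InformationTheory in
/-- A linearized form of Pinsker's inequality. -/
theorem lintegral_le_add_klDiv {α : Type*} [MeasurableSpace α] (μ ν : Measure α)
    [IsProbabilityMeasure μ] [IsProbabilityMeasure ν] {l : ℝ} (hl : 0 < l)
    {φ : α → ENNReal} (hφ : Measurable φ) {b : ENNReal} (hb : ∀ a, φ a ≤ b) :
    ∫⁻ a, φ a ∂μ ≤ ∫⁻ a, φ a ∂ν +
      b * (ENNReal.ofReal (2 * l) + klDiv μ ν * ENNReal.ofReal (1 / (2 * l))) := by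
  by_cases hac : μ ≪ ν
  swap
  · rw [klDiv_of_not_ac hac, ENNReal.top_mul (by simpa using hl), add_top]
    rcases eq_or_ne b 0 with rfl | hb0
    · simp [le_antisymm (hb _) (zero_le)]
    · simp [ENNReal.mul_top hb0]
  have hr : ∀ᵐ a ∂ν, μ.rnDeriv ν a ≤ 1 + (ENNReal.ofReal l * (μ.rnDeriv ν a + 1) +
      ENNReal.ofReal (klFun (μ.rnDeriv ν a).toReal) * ENNReal.ofReal (1 / (2 * l))) := by
    filter_upwards [μ.rnDeriv_lt_top ν] with a ha
    have h := ENNReal.ofReal_le_ofReal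
      (le_one_add_klFun (x := (μ.rnDeriv ν a).toReal) ENNReal.toReal_nonneg hl)
    have hk := klFun_nonneg (x := (μ.rnDeriv ν a).toReal) ENNReal.toReal_nonneg
    rw [ENNReal.ofReal_add (by positivity) (by positivity),
      ENNReal.ofReal_add (by positivity) (by positivity), ENNReal.ofReal_mul hl.le,
      ENNReal.ofReal_add (by positivity) (by positivity), div_eq_mul_one_div,
      ENNReal.ofReal_mul hk, ENNReal.ofReal_toReal ha.ne, ENNReal.ofReal_one] at h
    exact h
  have hm : Measurable fun a => ENNReal.ofReal (klFun (μ.rnDeriv ν a).toReal) := by fun_prop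
  calc ∫⁻ a, φ a ∂μ = ∫⁻ a, μ.rnDeriv ν a * φ a ∂ν :=
        (lintegral_rnDeriv_mul hac hφ.aemeasurable).symm
    _ ≤ ∫⁻ a, (φ a + b * (ENNReal.ofReal l * (μ.rnDeriv ν a + 1) +
        ENNReal.ofReal (klFun (μ.rnDeriv ν a).toReal) * ENNReal.ofReal (1 / (2 * l)))) ∂ν := by
        refine lintegral_mono_ae ?_
        filter_upwards [hr] with a ha
        refine (mul_le_mul_left ha (φ a)).trans ?_
        rw [add_mul, one_mul, mul_comm (_ + _) (φ a)]
        exact add_le_add le_rfl (mul_le_mul_left (hb a) _)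
    -- The density has mean one, so `l * (x + 1)` integrates to `2l`.
    _ = _ := by
        rw [lintegral_add_left hφ, lintegral_const_mul _ (by fun_prop),
          lintegral_add_left (by fun_prop), lintegral_const_mul _ (by fun_prop),
          lintegral_add_left (by fun_prop), Measure.lintegral_rnDeriv hac,
          lintegral_mul_const _ hm, klDiv_eq_lintegral_klFun_of_ac hac]
        simp only [measure_univ, lintegral_const, mul_one]
        rw [mul_comm 2 l, ENNReal.ofReal_mul hl.le]
        norm_num [one_add_one_eq_two]

-- Kernels have jointly measurable Radon-Nikodym derivatives, and absolute continuity is a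
-- measurable condition on the parameter.
open InformationTheory in
theorem measurable_klDiv_kernel {α γ : Type*} [MeasurableSpace α] [MeasurableSpace γ]
    [MeasurableSpace.CountableOrCountablyGenerated α γ] (κ η : Kernel α γ)
    [IsFiniteKernel κ] [IsFiniteKernel η] : Measurable fun a => klDiv (κ a) (η a) := by
  classical
  have h : (fun a => klDiv (κ a) (η a)) = fun a => if κ a ≪ η a then
      ∫⁻ x, ENNReal.ofReal (klFun (Kernel.rnDeriv κ η a x).toReal) ∂(η a) else ⊤ := by
    ext a
    rw [klDiv_eq_lintegral_klFun]
    congr 1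
    refine lintegral_congr_ae ?_
    filter_upwards [Kernel.rnDeriv_eq_rnDeriv_measure (κ := κ) (η := η) (a := a)] with x hx
    rw [hx]
  rw [h]
  refine Measurable.ite (Kernel.measurableSet_absolutelyContinuous κ η) ?_ measurable_const
  refine Measurable.lintegral_kernel_prod_right (κ := η) ?_
  have := Kernel.measurable_rnDeriv κ η
  simp only [Function.uncurry_def]
  exact (measurable_klFun.comp this.ennreal_toReal).ennreal_ofReal

open InformationTheory in
/-- Change of the reference measure in the Kullback-Leibler divergence by a bounded
log-density. -/
theorem klDiv_withDensity_exp {α : Type*} [MeasurableSpace α] (q p : Measure α)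
    [IsProbabilityMeasure q] [IsProbabilityMeasure p] {g : α → ℝ} (hg : Measurable g) {c : ℝ}
    (hc : ∀ a, |g a| ≤ c) (h1 : ∫⁻ a, ENNReal.ofReal (Real.exp (g a)) ∂p = 1)
    (hkl : klDiv q p ≠ ⊤) :
    0 ≤ (klDiv q p).toReal - ∫ a, g a ∂q ∧
    klDiv q (p.withDensity fun a => ENNReal.ofReal (Real.exp (g a))) =
      ENNReal.ofReal ((klDiv q p).toReal - ∫ a, g a ∂q) := by
  obtain ⟨hac, hint⟩ := klDiv_ne_top_iff.1 hkl
  have hexp : Integrable (fun a => Real.exp (g a)) p := by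
    refine ⟨by fun_prop, ?_⟩
    rw [hasFiniteIntegral_iff_ofReal (ae_of_all _ fun a => (Real.exp_pos _).le), h1]
    exact ENNReal.one_lt_top
  have hexp1 : ∫ a, Real.exp (g a) ∂p = 1 := by
    rw [integral_eq_lintegral_of_nonneg_ae (ae_of_all _ fun a => (Real.exp_pos _).le)
      (by fun_prop), h1, ENNReal.toReal_one]
  have hgq : Integrable g q :=
    Integrable.of_bound hg.aestronglyMeasurable c (ae_of_all _ hc)
  -- By `h1` the normalizing constant is one, so this density is exactly an exponential tilting.
  have htilt : (p.withDensity fun a => ENNReal.ofReal (Real.exp (g a))) = p.tilted g := by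
    simp [Measure.tilted, hexp1]
  have : IsProbabilityMeasure (p.tilted g) := isProbabilityMeasure_tilted hexp
  have hac' : q ≪ p.tilted g := hac.trans (absolutelyContinuous_tilted hexp)
  have hint' := integrable_llr_tilted_right hac hgq hint hexp
  have hne := klDiv_ne_top hac' hint'
  have heq : (klDiv q (p.tilted g)).toReal = (klDiv q p).toReal - ∫ a, g a ∂q := by
    rw [toReal_klDiv_of_measure_eq hac' (by simp), toReal_klDiv_of_measure_eq hac (by simp),
      integral_llr_tilted_right hac hgq hexp hint, hexp1, Real.log_one, add_zero]
  rw [htilt, ← heq, ENNReal.ofReal_toReal hne]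
  exact ⟨ENNReal.toReal_nonneg, rfl⟩

/-! ### Trajectories, occupancies and performance difference -/

namespace RCSL

variable {O A S : Type*} [MeasurableSpace O] [MeasurableSpace A] [MeasurableSpace S]

/-- The history at step `t` of a trajectory. -/
def histAt {n : ℕ} (τ : Traj O A n) (t : Fin n) : Hist O A t :=
  (fun i => τ (Fin.castLE t.2.le i), (τ t).1)

theorem measurable_histAt {n : ℕ} (t : Fin n) :
    Measurable fun τ : Traj O A n => histAt τ t := by
  unfold histAt
  fun_prop

theorem measurable_stateAt (φ : StateRep O A S) {H : ℕ} :
    Measurable fun x : Traj O A H × Fin H => stateAt φ x.1 x.2 :=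
  measurable_from_prod_countable_left fun t =>
    (φ.measurable_toState t).comp (measurable_histAt t)

theorem measurable_actionAt {H : ℕ} :
    Measurable fun x : Traj O A H × Fin H => actionAt x.1 x.2 :=
  measurable_from_prod_countable_left fun t => by unfold actionAt; fun_prop

theorem measurable_ret {H : ℕ} : Measurable fun τ : Traj O A H => ret τ := by
  unfold ret
  refine Finset.measurable_sum _ fun t _ => ?_
  exact measurable_subtype_coe.comp (by fun_prop)

omit [MeasurableSpace O] [MeasurableSpace A] in
theorem ret_nonneg {H : ℕ} (τ : Traj O A H) : 0 ≤ ret τ :=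
  Finset.sum_nonneg fun t _ => (τ t).2.2.2.1

omit [MeasurableSpace O] [MeasurableSpace A] in
theorem ret_le {H : ℕ} (τ : Traj O A H) : ret τ ≤ H := by
  have : ret τ ≤ ∑ _t : Fin H, (1 : ℝ) := Finset.sum_le_sum fun t _ => (τ t).2.2.2.2
  simpa using this

omit [MeasurableSpace O] [MeasurableSpace A] in
theorem histAt_extend_last {n : ℕ} (x : (Hist O A n × A) × (unitInterval × O)) :
    (histAt (extend n x).1 (Fin.last n) : Hist O A n) = x.1.1 := by
  refine Prod.ext (funext fun i => ?_) ?_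
  · exact Fin.snoc_castSucc (α := fun _ => Step O A) _ _ i
  · exact congrArg Prod.fst (Fin.snoc_last (α := fun _ => Step O A) _ _)

omit [MeasurableSpace O] [MeasurableSpace A] in
theorem histAt_extend_castSucc {n : ℕ} (x : (Hist O A n × A) × (unitInterval × O)) (t : Fin n) :
    (histAt (extend n x).1 t.castSucc : Hist O A t) = histAt x.1.1.1 t := by
  refine Prod.ext (funext fun i => ?_) ?_
  · exact Fin.snoc_castSucc (α := fun _ => Step O A) _ _ (Fin.castLE t.2.le i)
  · exact congrArg Prod.fst (Fin.snoc_castSucc (α := fun _ => Step O A) _ _ t)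

/-- Later steps are appended by Markov kernels, which leave the law of the past unchanged. -/
theorem map_histAt_histLaw (M : MDP O A) (φ : StateRep O A S) (π : Kernel S A)
    [IsMarkovKernel π] : ∀ (n : ℕ) (t : Fin n),
      (histLaw M φ π n).map (fun h => histAt h.1 t) = histLaw M φ π t := by
  intro n
  induction n with
  | zero => exact fun t => t.elim0
  | succ n ih =>
    intro t
    have hm : ((histLaw M φ π n ⊗ₘ π.comap (φ.toState n) (φ.measurable_toState n)) ⊗ₘ
        (M.trans n).comap (fun x : Hist O A n × A => (x.1.2, x.2)) (by fun_prop)).map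
        (fun x => x.1.1) = histLaw M φ π n := by
      have : (fun x : (Hist O A n × A) × (unitInterval × O) => x.1.1) = Prod.fst ∘ Prod.fst := rfl
      rw [this, ← Measure.map_map measurable_fst measurable_fst, ← Measure.fst, ← Measure.fst,
        Measure.fst_compProd, Measure.fst_compProd]
    have hq : ∀ (k : ℕ) (t : Fin k), Measurable fun h : Hist O A k => histAt h.1 t :=
      fun k t => (measurable_histAt t).comp measurable_fst
    rw [histLaw, Measure.map_map (hq _ t) (measurable_extend n)]
    refine Fin.lastCases ?_ (fun t => ?_) t
    · exact (congrArg (fun g => Measure.map g _) (funext histAt_extend_last)).trans hm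
    · have h2 := ih t
      rw [← hm, Measure.map_map (hq _ t) (by fun_prop)] at h2
      exact (congrArg (fun g => Measure.map g _)
        (funext fun x => histAt_extend_castSucc x t)).trans h2

theorem lintegral_histLaw_succ (M : MDP O A) (φ : StateRep O A S) (π : Kernel S A)
    [IsMarkovKernel π] (t : ℕ) {F : Hist O A (t + 1) → ENNReal} (hF : Measurable F) :
    ∫⁻ h, F h ∂(histLaw M φ π (t + 1)) =
      ∫⁻ h, ∫⁻ a, ∫⁻ y, F (extend t ((h, a), y)) ∂(M.trans t (h.2, a)) ∂(π (φ.toState t h))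
        ∂(histLaw M φ π t) := by
  have h1 : Measurable fun x => F (extend t x) := hF.comp (measurable_extend t)
  rw [histLaw, lintegral_map hF (measurable_extend t), Measure.lintegral_compProd h1,
    Measure.lintegral_compProd (Measurable.lintegral_kernel_prod_right' h1)]
  rfl

/-- Hybrid argument from the last step backwards. Switching the last action from `π` to `π'` costs
`R * B` averaged over histories drawn from `π`; what remains is a function of the shorter history,
still bounded by `R`. All error terms are therefore taken under `π`. `F` sees the whole history, so
the state need not be Markov. -/
theorem lintegral_histLaw_le (M : MDP O A) (φ : StateRep O A S) (π π' : Kernel S A)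
    [IsMarkovKernel π] [IsMarkovKernel π'] {R : ENNReal} {B : S → ENNReal} (hB : Measurable B)
    (hππ' : ∀ s, ∀ ψ : A → ENNReal, Measurable ψ → (∀ a, ψ a ≤ R) →
      ∫⁻ a, ψ a ∂(π s) ≤ ∫⁻ a, ψ a ∂(π' s) + R * B s) (t : ℕ) :
    ∀ F : Hist O A t → ENNReal, Measurable F → (∀ h, F h ≤ R) →
      ∫⁻ h, F h ∂(histLaw M φ π t) ≤ ∫⁻ h, F h ∂(histLaw M φ π' t) +
        R * ∑ i ∈ Finset.range t, ∫⁻ h, B (φ.toState i h) ∂(histLaw M φ π i) := by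
  induction t with
  | zero => intro F hF hR; simp [histLaw]
  | succ t ih =>
    intro F hF hR
    have h1 : Measurable fun x => F (extend t x) := hF.comp (measurable_extend t)
    have hG : Measurable fun x : Hist O A t × A =>
        ∫⁻ y, F (extend t (x, y)) ∂(M.trans t (x.1.2, x.2)) :=
      Measurable.lintegral_kernel_prod_right'
        (κ := (M.trans t).comap (fun x : Hist O A t × A => (x.1.2, x.2)) (by fun_prop)) h1
    have hGR : ∀ x : Hist O A t × A,
        ∫⁻ y, F (extend t (x, y)) ∂(M.trans t (x.1.2, x.2)) ≤ R := fun x =>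
      (lintegral_mono fun y => hR _).trans (by simp)
    have hF' : Measurable fun h : Hist O A t => ∫⁻ a,
        ∫⁻ y, F (extend t ((h, a), y)) ∂(M.trans t (h.2, a)) ∂(π' (φ.toState t h)) :=
      Measurable.lintegral_kernel_prod_right'
        (κ := π'.comap (φ.toState t) (φ.measurable_toState t)) hG
    have hF'R : ∀ h : Hist O A t, ∫⁻ a, ∫⁻ y, F (extend t ((h, a), y)) ∂(M.trans t (h.2, a))
        ∂(π' (φ.toState t h)) ≤ R := fun h =>
      (lintegral_mono fun a => hGR (h, a)).trans (by simp)
    have hBt : Measurable fun h => B (φ.toState t h) := hB.comp (φ.measurable_toState t)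
    rw [lintegral_histLaw_succ _ _ _ _ hF, lintegral_histLaw_succ _ _ _ _ hF]
    refine (lintegral_mono fun h => hππ' (φ.toState t h) _
      (hG.comp measurable_prodMk_left) fun a => hGR (h, a)).trans ?_
    simp only [Function.comp_def]
    rw [lintegral_add_left hF', lintegral_const_mul R hBt, Finset.sum_range_succ, mul_add,
      ← add_assoc]
    exact add_le_add (ih _ hF' hF'R) le_rfl

theorem uniformOn_univ_fin (H : ℕ) :
    (uniformOn Set.univ : Measure (Fin H)) = (H : ENNReal)⁻¹ • Measure.count := by
  ext s hs
  rw [uniformOn_univ, Measure.smul_apply, smul_eq_mul, Fintype.card_fin, ENNReal.div_eq_inv_mul]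

theorem lintegral_stateLaw (M : MDP O A) (φ : StateRep O A S) (H : ℕ) (π : Kernel S A)
    [IsMarkovKernel π] {B : S → ENNReal} (hB : Measurable B) :
    ∫⁻ s, B s ∂(stateLaw M φ H π) =
      (H : ENNReal)⁻¹ * ∑ i ∈ Finset.range H, ∫⁻ h, B (φ.toState i h) ∂(histLaw M φ π i) := by
  have hBs : Measurable fun x : Traj O A H × Fin H => B (stateAt φ x.1 x.2) :=
    hB.comp (measurable_stateAt φ)
  rw [stateLaw, lintegral_map hB (measurable_stateAt φ), stepLaw, lintegral_prod_symm' _ hBs,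
    uniformOn_univ_fin, lintegral_smul_measure, lintegral_count,
    tsum_fintype, smul_eq_mul, Finset.sum_range]
  congr 2 with t
  have hBt : Measurable fun h => B (φ.toState t h) := hB.comp (φ.measurable_toState t)
  have hq : Measurable fun h : Hist O A H => histAt h.1 t :=
    (measurable_histAt t).comp measurable_fst
  rw [← map_histAt_histLaw M φ π H t, lintegral_map hBt hq, trajLaw, lintegral_map _ measurable_fst]
  · rfl
  · exact hBs.comp measurable_prodMk_right

theorem ofReal_J (M : MDP O A) (φ : StateRep O A S) (H : ℕ) (π : Kernel S A) [IsMarkovKernel π] :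
    ENNReal.ofReal (J M φ H π) = ∫⁻ h, ENNReal.ofReal (ret h.1) ∂(histLaw M φ π H) := by
  have hi : Integrable (fun τ : Traj O A H => ret τ) (trajLaw M φ H π) :=
    Integrable.of_bound measurable_ret.aestronglyMeasurable H (ae_of_all _ fun τ => by
      rw [Real.norm_of_nonneg (ret_nonneg τ)]; exact ret_le τ)
  rw [J, ofReal_integral_eq_lintegral_ofReal hi (ae_of_all _ ret_nonneg), trajLaw,
    lintegral_map measurable_ret.ennreal_ofReal measurable_fst]

/-- Performance difference: a bound on one-step expectations under two policies yields a bound on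
the difference of their expected returns. -/
theorem ofReal_J_le (M : MDP O A) (φ : StateRep O A S) {H : ℕ} (hH : 1 ≤ H) (π π' : Kernel S A)
    [IsMarkovKernel π] [IsMarkovKernel π'] {B : S → ENNReal} (hB : Measurable B)
    (hππ' : ∀ s, ∀ ψ : A → ENNReal, Measurable ψ → (∀ a, ψ a ≤ H) →
      ∫⁻ a, ψ a ∂(π s) ≤ ∫⁻ a, ψ a ∂(π' s) + H * B s) :
    ENNReal.ofReal (J M φ H π) ≤
      ENNReal.ofReal (J M φ H π') + (H : ENNReal) ^ 2 * ∫⁻ s, B s ∂(stateLaw M φ H π) := by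
  -- One factor `H` bounds the return; the other turns the sum over steps into the average defining
  -- `stateLaw`.
  rw [ofReal_J, ofReal_J, lintegral_stateLaw M φ H π hB, sq, mul_assoc,
    ← mul_assoc (H : ENNReal) (H : ENNReal)⁻¹, ENNReal.mul_inv_cancel (by simp; omega) (by simp),
    one_mul]
  refine lintegral_histLaw_le M φ π π' hB hππ' H _
    (measurable_ret.comp measurable_fst).ennreal_ofReal fun h => ?_
  exact (ENNReal.ofReal_le_ofReal (ret_le _)).trans (by simp)

end RCSL

/-! ### Concentration -/

/-- Hoeffding's inequality: an average of `N` independent copies of a variable whose range has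
length `w` and whose mean is large is unlikely to be nonpositive. -/
theorem measure_pi_sum_nonpos_le {Z : Type*} [MeasurableSpace Z] (μ : Measure Z)
    [IsProbabilityMeasure μ] {Y : Z → ℝ} (hY : Measurable Y) {a w : ℝ} (hw : 0 ≤ w)
    (hYa : ∀ z, Y z ∈ Set.Icc a (a + w)) {N : ℕ} (hN : 1 ≤ N) {η : ℝ} (hη : 0 < η)
    (hm : w * √(Real.log (1 / η) / N) < ∫ z, Y z ∂μ) :
    Measure.pi (fun _ : Fin N => μ) {D | ∑ i, Y (D i) ≤ 0} ≤ ENNReal.ofReal η := by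
  set m := ∫ z, Y z ∂μ with hmdef
  have hm0 : 0 < m := lt_of_le_of_lt (by positivity) hm
  have hN0 : (0 : ℝ) < N := by exact_mod_cast hN
  -- For `w = 0` the Hoeffding exponent is a division by zero and says nothing; but then `Y` is a
  -- positive constant.
  rcases hw.eq_or_lt with rfl | hw0
  · have hc : ∀ z, Y z = a := fun z => le_antisymm (by simpa using (hYa z).2) (hYa z).1
    have : m = a := by simp [hmdef, hc]
    have he : {D : Fin N → Z | ∑ i, Y (D i) ≤ 0} = ∅ := by
      ext D
      simp only [hc, Set.mem_ofPred_eq, Set.mem_empty_iff_false, iff_false, not_le]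
      rw [← this]
      simp only [Finset.sum_const, Finset.card_univ, Fintype.card_fin, nsmul_eq_mul]
      positivity
    rw [he]; simp
  set ρ := Measure.pi (fun _ : Fin N => μ)
  have hind : iIndepFun (fun (i : Fin N) (D : Fin N → Z) => m - Y (D i)) ρ :=
    iIndepFun_pi (μ := fun _ : Fin N => μ) (X := fun _ z => m - Y z)
      fun _ => (measurable_const.sub hY).aemeasurable
  have hint : ∀ i : Fin N, ∫ D, -Y (D i) ∂ρ = -m := by
    intro i
    rw [integral_neg]
    congr 1
    exact integral_comp_eval (μ := fun _ : Fin N => μ) hY.aestronglyMeasurable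
  have hsub : ∀ i ∈ Finset.univ, HasSubgaussianMGF (fun D : Fin N → Z => m - Y (D i))
      ((‖(-a) - (-(a + w))‖₊ / 2) ^ 2) ρ := by
    intro i _
    have h := hasSubgaussianMGF_of_mem_Icc (μ := ρ) (X := fun D : Fin N → Z => -Y (D i))
      (a := -(a + w)) (b := -a) (by
        exact (hY.comp (measurable_pi_apply i)).neg.aemeasurable)
      (ae_of_all _ fun D => ⟨neg_le_neg (hYa (D i)).2, neg_le_neg (hYa (D i)).1⟩)
    rw [hint] at h
    convert h using 2
    ring
  have key := HasSubgaussianMGF.measure_sum_ge_le_of_iIndepFun hind hsub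
    (ε := N * m) (by positivity)
  have hset : {D : Fin N → Z | ∑ i, Y (D i) ≤ 0} = {D | N * m ≤ ∑ i, (m - Y (D i))} := by
    ext D
    simp [Finset.sum_sub_distrib]
  rw [hset, ← ofReal_measureReal]
  refine ENNReal.ofReal_le_ofReal (key.trans ?_)
  rw [← Real.le_log_iff_exp_le hη]
  simp only [neg_sub_neg, add_sub_cancel_left, Finset.sum_const, Finset.card_univ,
    Fintype.card_fin, nsmul_eq_mul, NNReal.coe_mul, NNReal.coe_natCast, NNReal.coe_pow,
    NNReal.coe_div, coe_nnnorm, Real.norm_eq_abs, NNReal.coe_ofNat]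
  rw [div_le_iff₀ (by positivity), div_pow, sq_abs]
  rw [one_div, Real.log_inv] at hm
  set l := Real.log η
  -- For `η ≥ 1` the claim is trivial. Otherwise squaring `hm` gives twice the exponent needed.
  rcases le_or_gt 0 l with hl | hl
  · have h1 : 0 ≤ l * (2 * (N * (w ^ 2 / 2 ^ 2))) := by positivity
    have : 0 ≤ ((N : ℝ) * m) ^ 2 := by positivity
    linarith
  have h2 : (w * √(-l / N)) ^ 2 ≤ m ^ 2 := by gcongr
  rw [mul_pow, Real.sq_sqrt (div_nonneg (by linarith) hN0.le)] at h2
  have h3 : (N : ℝ) * (w ^ 2 * (-l / N)) = w ^ 2 * (-l) := by field_simp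
  have h4 : (N : ℝ) * (w ^ 2 * (-l / N)) ≤ N * m ^ 2 := by gcongr
  rw [h3] at h4
  have h5 : (N : ℝ) * (w ^ 2 * (-l)) ≤ N * (N * m ^ 2) := by gcongr
  have h6 : 0 ≤ (N : ℝ) * (w ^ 2 * (-l)) :=
    mul_nonneg hN0.le (mul_nonneg (sq_nonneg _) (by linarith))
  nlinarith

/-! ### Conditional laws and population loss -/

namespace RCSL

variable {O A S : Type*} [MeasurableSpace O] [MeasurableSpace A] [MeasurableSpace S]
  {ν : Measure A}

theorem stepLaw_prob (M : MDP O A) (φ : StateRep O A S) {H : ℕ} (hH : 1 ≤ H) (π : Kernel S A)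
    [IsMarkovKernel π] : IsProbabilityMeasure (stepLaw M φ H π) := by
  have : NeZero H := ⟨by omega⟩
  have : IsProbabilityMeasure (uniformOn Set.univ : Measure (Fin H)) :=
    isProbabilityMeasure_uniformOn Set.finite_univ Set.univ_nonempty
  unfold stepLaw
  infer_instance

theorem stateLaw_prob (M : MDP O A) (φ : StateRep O A S) {H : ℕ} (hH : 1 ≤ H) (π : Kernel S A)
    [IsMarkovKernel π] : IsProbabilityMeasure (stateLaw M φ H π) := by
  have := stepLaw_prob M φ hH π
  exact Measure.isProbabilityMeasure_map (measurable_stateAt φ).aemeasurable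

instance returnGivenState_markov (M : MDP O A) (φ : StateRep O A S) (H : ℕ) (β : Kernel S A)
    [IsMarkovKernel β] : IsMarkovKernel (returnGivenState M φ H β) := by
  unfold returnGivenState; infer_instance

instance actionGivenStateReturn_markov [StandardBorelSpace A] [Nonempty A] (M : MDP O A)
    (φ : StateRep O A S) (H : ℕ) (β : Kernel S A) [IsMarkovKernel β] :
    IsMarkovKernel (actionGivenStateReturn M φ H β) := by
  unfold actionGivenStateReturn; infer_instance

instance conditionOn_markov (π : Kernel (S × ℝ) A) [IsMarkovKernel π] (f : S → ℝ)
    (hf : Measurable f) : IsMarkovKernel (conditionOn π f hf) := by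
  unfold conditionOn; infer_instance

instance rcslPolicy_markov [StandardBorelSpace A] [Nonempty A] (M : MDP O A)
    (φ : StateRep O A S) (H : ℕ) (β : Kernel S A) [IsMarkovKernel β] (f : S → ℝ)
    (hf : Measurable f) : IsMarkovKernel (rcslPolicy M φ H β f hf) := by
  unfold rcslPolicy; infer_instance

theorem measurable_stateAt_ret (φ : StateRep O A S) {H : ℕ} :
    Measurable fun x : Traj O A H × Fin H => (stateAt φ x.1 x.2, ret x.1) :=
  (measurable_stateAt φ).prodMk (measurable_ret.comp measurable_fst)

theorem stateLaw_compProd_returnGivenState (M : MDP O A) (φ : StateRep O A S) (H : ℕ)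
    (β : Kernel S A) [IsMarkovKernel β] :
    stateLaw M φ H β ⊗ₘ returnGivenState M φ H β =
      (stepLaw M φ H β).map fun x => (stateAt φ x.1 x.2, ret x.1) :=
  compProd_map_condDistrib (measurable_ret.comp measurable_fst).aemeasurable

theorem compProd_actionGivenStateReturn [StandardBorelSpace A] [Nonempty A] (M : MDP O A)
    (φ : StateRep O A S) (H : ℕ) (β : Kernel S A) [IsMarkovKernel β] :
    (stateLaw M φ H β ⊗ₘ returnGivenState M φ H β) ⊗ₘ actionGivenStateReturn M φ H β =
      (stepLaw M φ H β).map fun x => ((stateAt φ x.1 x.2, ret x.1), actionAt x.1 x.2) := by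
  rw [stateLaw_compProd_returnGivenState]
  exact compProd_map_condDistrib measurable_actionAt.aemeasurable

/-- Integration of a bounded function over the step law is integration of its average over the
steps of a trajectory. -/
theorem integral_stepLaw (M : MDP O A) (φ : StateRep O A S) (H : ℕ) (π : Kernel S A)
    [IsMarkovKernel π] {F : Traj O A H × Fin H → ℝ} (hF : Measurable F) {b : ℝ}
    (hb : ∀ x, |F x| ≤ b) :
    ∫ x, F x ∂(stepLaw M φ H π) = ∫ τ, (H : ℝ)⁻¹ * ∑ t, F (τ, t) ∂(trajLaw M φ H π) := by
  have hi : Integrable F (stepLaw M φ H π) :=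
    Integrable.of_bound hF.aestronglyMeasurable b (ae_of_all _ hb)
  rw [stepLaw] at hi ⊢
  rw [integral_prod _ hi]
  congr 1 with τ
  rw [uniformOn_univ_fin, integral_smul_measure, integral_count]
  simp

/-- The log-likelihood ratio of two return-conditioned policies. -/
noncomputable def logRatio (π₀ π : RCPolicy S ν) (x : (S × ℝ) × A) : ℝ :=
  Real.log (π₀.lik x.1.1 x.1.2 x.2) - Real.log (π.lik x.1.1 x.1.2 x.2)

theorem measurable_logRatio (π₀ π : RCPolicy S ν) : Measurable (logRatio π₀ π) :=
  π₀.measurable_lik.log.sub π.measurable_lik.log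

theorem RCPolicy.toKernel_apply [SFinite ν] (π : RCPolicy S ν) (x : S × ℝ) :
    π.toKernel x = ν.withDensity fun a => ENNReal.ofReal (π.lik x.1 x.2 a) := by
  rw [RCPolicy.toKernel, Kernel.withDensity_apply _ (by
    simpa [Function.uncurry_def] using π.measurable_lik.ennreal_ofReal)]
  rfl

/-- Positivity makes `exp(-logRatio)` the true quotient of likelihoods, so `π` is a tilting of `π₀`
and `klDiv_withDensity_exp` applies. -/
theorem toKernel_eq_withDensity [SFinite ν] (π₀ π : RCPolicy S ν)
    (h₀ : ∀ s g a, 0 < π₀.lik s g a) (h : ∀ s g a, 0 < π.lik s g a) (x : S × ℝ) :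
    π.toKernel x = (π₀.toKernel x).withDensity
      fun a => ENNReal.ofReal (Real.exp (-logRatio π₀ π (x, a))) := by
  have hm₀ : Measurable fun a => ENNReal.ofReal (π₀.lik x.1 x.2 a) :=
    (π₀.measurable_lik.comp measurable_prodMk_left).ennreal_ofReal
  have hmr : Measurable fun a => ENNReal.ofReal (Real.exp (-logRatio π₀ π (x, a))) :=
    ((measurable_logRatio π₀ π).comp measurable_prodMk_left).neg.exp.ennreal_ofReal
  rw [RCPolicy.toKernel_apply, RCPolicy.toKernel_apply, ← withDensity_mul _ hm₀ hmr]
  congr 1 with a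
  rw [Pi.mul_apply, ← ENNReal.ofReal_mul (h₀ _ _ _).le, logRatio, neg_sub, Real.exp_sub,
    Real.exp_log (h _ _ _), Real.exp_log (h₀ _ _ _), mul_div_cancel₀ _ (h₀ _ _ _).ne']

-- Pointwise `KL(q ‖ π) = KL(q ‖ π₀) + E_q log(π₀/π)` wherever the first divergence on the right is
-- finite, hence almost everywhere. Disintegration turns the mean of the last term into an
-- expectation over trajectories. The bound `b` serves only integrability.
open InformationTheory in
theorem loss_le [StandardBorelSpace A] [Nonempty A] [SFinite ν] (M : MDP O A)
    (φ : StateRep O A S) {H : ℕ} (hH : 1 ≤ H) (β : Kernel S A) [IsMarkovKernel β]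
    (π₀ π : RCPolicy S ν) (h₀ : ∀ s g a, 0 < π₀.lik s g a) (h : ∀ s g a, 0 < π.lik s g a)
    {b : ℝ} (hb : ∀ x, |logRatio π₀ π x| ≤ b) {ε : ℝ} (hε : 0 ≤ ε)
    (hloss : loss M φ H β π₀ ≤ ENNReal.ofReal ε) :
    loss M φ H β π ≤ ENNReal.ofReal (ε + ∫ τ, (H : ℝ)⁻¹ * ∑ t,
      logRatio π₀ π ((stateAt φ τ t, ret τ), actionAt τ t) ∂(trajLaw M φ H β)) := by
  have := stateLaw_prob M φ hH β
  set μ := stateLaw M φ H β ⊗ₘ returnGivenState M φ H β with hμ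
  set q := actionGivenStateReturn M φ H β with hq
  have hmk : Measurable fun x => klDiv (q x) (π₀.toKernel x) := measurable_klDiv_kernel _ _
  have hml := measurable_logRatio π₀ π
  have hfin : ∫⁻ x, klDiv (q x) (π₀.toKernel x) ∂μ ≠ ⊤ :=
    (lt_of_le_of_lt hloss ENNReal.ofReal_lt_top).ne
  have hpt : ∀ᵐ x ∂μ, 0 ≤ (klDiv (q x) (π₀.toKernel x)).toReal +
      ∫ a, logRatio π₀ π (x, a) ∂(q x) ∧ klDiv (q x) (π.toKernel x) =
      ENNReal.ofReal ((klDiv (q x) (π₀.toKernel x)).toReal +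
        ∫ a, logRatio π₀ π (x, a) ∂(q x)) := by
    filter_upwards [ae_lt_top hmk hfin] with x hx
    have hw := toKernel_eq_withDensity π₀ π h₀ h x
    have h1 : ∫⁻ a, ENNReal.ofReal (Real.exp (-logRatio π₀ π (x, a))) ∂(π₀.toKernel x) = 1 := by
      rw [← setLIntegral_univ, ← withDensity_apply _ MeasurableSet.univ, ← hw, measure_univ]
    have := klDiv_withDensity_exp (q x) (π₀.toKernel x)
      (g := fun a => -logRatio π₀ π (x, a)) (hml.comp measurable_prodMk_left).neg
      (c := b) (fun a => by rw [abs_neg]; exact hb _) h1 hx.ne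
    rwa [← hw, integral_neg, sub_neg_eq_add] at this
  have hik : Integrable (fun x => (klDiv (q x) (π₀.toKernel x)).toReal) μ :=
    integrable_toReal_of_lintegral_ne_top hmk.aemeasurable hfin
  have hid : Integrable (logRatio π₀ π) (μ ⊗ₘ q) :=
    Integrable.of_bound hml.aestronglyMeasurable b (ae_of_all _ hb)
  have hir : Integrable (fun x => ∫ a, logRatio π₀ π (x, a) ∂(q x)) μ :=
    Integrable.integral_compProd (κ := Kernel.const Unit μ) (η := Kernel.prodMkLeft Unit q)
      (a := ()) hid
  have hmF : Measurable fun x : Traj O A H × Fin H =>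
      ((stateAt φ x.1 x.2, ret x.1), actionAt x.1 x.2) :=
    (measurable_stateAt_ret φ).prodMk measurable_actionAt
  have hmean : ∫ x, ∫ a, logRatio π₀ π (x, a) ∂(q x) ∂μ = ∫ τ, (H : ℝ)⁻¹ * ∑ t,
      logRatio π₀ π ((stateAt φ τ t, ret τ), actionAt τ t) ∂(trajLaw M φ H β) := by
    rw [← Measure.integral_compProd hid, hμ, hq, compProd_actionGivenStateReturn,
      integral_map hmF.aemeasurable hml.aestronglyMeasurable,
      integral_stepLaw M φ H β (F := fun x => logRatio π₀ π ((stateAt φ x.1 x.2, ret x.1), actionAt x.1 x.2))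
        (hml.comp hmF) fun x => hb _]
  calc loss M φ H β π = ∫⁻ x, ENNReal.ofReal ((klDiv (q x) (π₀.toKernel x)).toReal +
        ∫ a, logRatio π₀ π (x, a) ∂(q x)) ∂μ := lintegral_congr_ae (hpt.mono fun x hx => hx.2)
    _ = ENNReal.ofReal (∫ x, ((klDiv (q x) (π₀.toKernel x)).toReal +
        ∫ a, logRatio π₀ π (x, a) ∂(q x)) ∂μ) :=
        (ofReal_integral_eq_lintegral_ofReal (hik.add hir) (hpt.mono fun x hx => hx.1)).symm
    _ ≤ _ := by
        rw [integral_add hik hir, hmean, integral_toReal hmk.aemeasurable (ae_lt_top hmk hfin)]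
        gcongr
        exact ENNReal.toReal_le_of_le_ofReal hε hloss

/-- Under return coverage, evaluating at the conditioning function costs at most a factor
`1 / α`. -/
theorem lintegral_conditioned_le (μ : Measure S) [SFinite μ] (κ : Kernel S ℝ) [IsMarkovKernel κ]
    {f : S → ℝ} {α : ℝ} (hα : 0 < α) (hcov : ∀ᵐ s ∂μ, ENNReal.ofReal α ≤ κ s {f s})
    {B : S × ℝ → ENNReal} (hB : Measurable B) :
    ∫⁻ s, B (s, f s) ∂μ ≤ (ENNReal.ofReal α)⁻¹ * ∫⁻ x, B x ∂(μ ⊗ₘ κ) := by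
  rw [Measure.lintegral_compProd hB,
    ← lintegral_const_mul _ (Measurable.lintegral_kernel_prod_right' hB)]
  refine lintegral_mono_ae ?_
  filter_upwards [hcov] with s hs
  have h1 : B (s, f s) * κ s {f s} ≤ ∫⁻ g, B (s, g) ∂(κ s) := by
    rw [← lintegral_singleton (μ := κ s) (fun g => B (s, g))]
    exact setLIntegral_le_lintegral _ _
  calc B (s, f s) = (ENNReal.ofReal α)⁻¹ * (B (s, f s) * ENNReal.ofReal α) := by
        rw [mul_comm (B _), ← mul_assoc, ENNReal.inv_mul_cancel (by simpa) (by simp), one_mul]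
    _ ≤ _ := by gcongr; exact (mul_le_mul_right hs _).trans h1

/-- `ENNReal.ofReal C` vanishes for negative `C` and cannot dominate a probability measure. -/
theorem occupancy_const_nonneg [StandardBorelSpace A] [Nonempty A] (M : MDP O A)
    (φ : StateRep O A S) {H : ℕ} (hH : 1 ≤ H) (β : Kernel S A) [IsMarkovKernel β]
    {f : S → ℝ} (hf : Measurable f) {C : ℝ}
    (hocc : stateLaw M φ H (rcslPolicy M φ H β f hf) ≤ ENNReal.ofReal C • stateLaw M φ H β) :
    0 ≤ C := by
  have := stateLaw_prob M φ hH (rcslPolicy M φ H β f hf)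
  by_contra! hC
  have h := hocc Set.univ
  rw [Measure.smul_apply, ENNReal.ofReal_of_nonpos hC.le, zero_smul, measure_univ] at h
  simp at h

open InformationTheory in
theorem J_rcslPolicy_le [StandardBorelSpace A] [Nonempty A] [SFinite ν] (M : MDP O A)
    (φ : StateRep O A S) {H : ℕ} (hH : 1 ≤ H) (β : Kernel S A) [IsMarkovKernel β]
    {f : S → ℝ} (hf : Measurable f) {C α : ℝ} (hα : 0 < α)
    (hocc : stateLaw M φ H (rcslPolicy M φ H β f hf) ≤ ENNReal.ofReal C • stateLaw M φ H β)
    (hcov : ∀ᵐ s ∂(stateLaw M φ H β), ENNReal.ofReal α ≤ returnGivenState M φ H β s {f s})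
    (π : RCPolicy S ν) {ℓ : ℝ} (hℓ : 0 ≤ ℓ)
    (hloss : loss M φ H β π ≤ ENNReal.ofReal ℓ) :
    J M φ H (rcslPolicy M φ H β f hf) - J M φ H (conditionOn π.toKernel f hf) ≤
      C / α * (H : ℝ) ^ 2 * (2 * √ℓ) := by
  have := stateLaw_prob M φ hH β
  have hC := occupancy_const_nonneg M φ hH β hf hocc
  have hJ' : 0 ≤ J M φ H (conditionOn π.toKernel f hf) := integral_nonneg ret_nonneg
  set q := actionGivenStateReturn M φ H β with hq
  have hmk : Measurable fun x => klDiv (q x) (π.toKernel x) := measurable_klDiv_kernel _ _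
  have key : ∀ l : ℝ, 0 < l → J M φ H (rcslPolicy M φ H β f hf) -
      J M φ H (conditionOn π.toKernel f hf) ≤ C / α * (H : ℝ) ^ 2 * (2 * l + ℓ / (2 * l)) := by
    intro l hl
    let B : S × ℝ → ENNReal := fun x =>
      ENNReal.ofReal (2 * l) + klDiv (q x) (π.toKernel x) * ENNReal.ofReal (1 / (2 * l))
    have hB : Measurable B := by fun_prop
    have hBf : Measurable fun s => B (s, f s) := hB.comp (measurable_id.prodMk hf)
    have h1 := ofReal_J_le M φ hH (rcslPolicy M φ H β f hf) (conditionOn π.toKernel f hf) hBf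
      fun s ψ hψ hψH => lintegral_le_add_klDiv (q (s, f s)) (π.toKernel (s, f s)) hl hψ hψH
    have h2 : ∫⁻ s, B (s, f s) ∂(stateLaw M φ H (rcslPolicy M φ H β f hf)) ≤
        ENNReal.ofReal C * ∫⁻ s, B (s, f s) ∂(stateLaw M φ H β) := by
      rw [← smul_eq_mul, ← lintegral_smul_measure]
      exact lintegral_mono' hocc le_rfl
    have h3 := lintegral_conditioned_le (stateLaw M φ H β) (returnGivenState M φ H β) hα hcov hB
    have h4 : ∫⁻ x, B x ∂(stateLaw M φ H β ⊗ₘ returnGivenState M φ H β) ≤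
        ENNReal.ofReal (2 * l + ℓ / (2 * l)) := by
      rw [lintegral_add_left measurable_const, lintegral_mul_const _ hmk, lintegral_const,
        measure_univ, mul_one, ENNReal.ofReal_add (by positivity) (by positivity),
        div_eq_mul_one_div ℓ, ENNReal.ofReal_mul hℓ]
      gcongr
      exact hloss
    have h5 : ENNReal.ofReal (J M φ H (rcslPolicy M φ H β f hf)) ≤
        ENNReal.ofReal (J M φ H (conditionOn π.toKernel f hf) +
          (H : ℝ) ^ 2 * (C * (α⁻¹ * (2 * l + ℓ / (2 * l))))) := by
      rw [ENNReal.ofReal_add hJ' (by positivity), ENNReal.ofReal_mul (by positivity),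
        ENNReal.ofReal_mul hC, ENNReal.ofReal_mul (by positivity), ENNReal.ofReal_inv_of_pos hα,
        ENNReal.ofReal_pow (by positivity), ENNReal.ofReal_natCast]
      refine h1.trans (add_le_add le_rfl (mul_le_mul_right (h2.trans ?_) _))
      exact mul_le_mul_right (h3.trans (mul_le_mul_right h4 _)) _
    have h6 := (ENNReal.ofReal_le_ofReal_iff (by positivity)).1 h5
    have h7 : (H : ℝ) ^ 2 * (C * (α⁻¹ * (2 * l + ℓ / (2 * l)))) =
        C / α * (H : ℝ) ^ 2 * (2 * l + ℓ / (2 * l)) := by ring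
    linarith
  rcases hℓ.eq_or_lt with rfl | hℓ
  -- Here no positive `l` is optimal, so `l` tends to zero; the `+ 1` below covers a vanishing
  -- prefactor.
  · rw [Real.sqrt_zero, mul_zero, mul_zero]
    refine le_of_forall_pos_le_add fun e he => ?_
    have hk : 0 ≤ C / α * (H : ℝ) ^ 2 := by positivity
    refine (key (e / (2 * (C / α * (H : ℝ) ^ 2 + 1))) (by positivity)).trans ?_
    rw [zero_div, add_zero, zero_add]
    set k := C / α * (H : ℝ) ^ 2
    have : k * (2 * (e / (2 * (k + 1)))) = e * (k / (k + 1)) := by field_simp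
    rw [this]
    exact mul_le_of_le_one_right he.le ((div_le_one (by positivity)).2 (by linarith))
  · have hs : 0 < √ℓ := Real.sqrt_pos.2 hℓ
    -- This `l` makes both terms equal to `√ℓ`.
    convert key (√ℓ / 2) (by positivity) using 2
    rw [mul_div_cancel₀ _ two_ne_zero, Real.div_sqrt]
    ring

end RCSL

/-! ### The regret bound -/

theorem corollary3 :
    ∃ K : ℝ, 0 < K ∧
      ∀ (O A S : Type*) [MeasurableSpace O] [MeasurableSpace S]
        [MeasurableSpace A] [StandardBorelSpace A] [Nonempty A]
        (ν : Measure A) [SigmaFinite ν]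
        (M : RCSL.MDP O A) (φ : RCSL.StateRep O A S) (H : ℕ) (_ : 1 ≤ H)
        (β : Kernel S A) [IsMarkovKernel β]
        (f : S → ℝ) (hf : Measurable f)
        (C α : ℝ) (_ : 0 < α)
        -- bounded occupancy mismatch
        (_ : RCSL.stateLaw M φ H (RCSL.rcslPolicy M φ H β f hf) ≤
          ENNReal.ofReal C • RCSL.stateLaw M φ H β)
        -- return coverage
        (_ : ∀ᵐ s ∂(RCSL.stateLaw M φ H β),
          ENNReal.ofReal α ≤ RCSL.returnGivenState M φ H β s {f s})
        -- finite policy class with log-likelihoods of range at most `c`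
        (P : Finset (RCSL.RCPolicy S ν)) (c : ℝ)
        (_ : ∀ π ∈ P, (∀ s g a, 0 < π.lik s g a) ∧
          ∀ s g a s' g' a', |Real.log (π.lik s g a) - Real.log (π.lik s' g' a')| ≤ c)
        -- approximation error
        (ε : ℝ) (_ : 0 ≤ ε)
        (_ : ∃ π ∈ P, RCSL.loss M φ H β π ≤ ENNReal.ofReal ε)
        (N : ℕ) (_ : 1 ≤ N) (δ : ℝ) (_ : 0 < δ) (_ : δ < 1),
        ENNReal.ofReal (1 - δ) ≤
          Measure.pi (fun _ : Fin N => RCSL.trajLaw M φ H β)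
            {D | ∀ π, RCSL.IsEmpMinimizer φ D P π →
              RCSL.J M φ H (RCSL.rcslPolicy M φ H β f hf) -
                  RCSL.J M φ H (RCSL.conditionOn π.toKernel f hf) ≤
                K * (C / α * (H : ℝ) ^ 2 *
                  (√c * (Real.log ((P.card : ℝ) / δ) / (N : ℝ)) ^ (1 / 4 : ℝ) + √ε))} := by
  -- The constant comes from `2√(ε + u) ≤ 2√ε + 2√u` and `√u = 2√c L^(1/4)`, with `u` and `L` as set
  -- below.
  refine ⟨4, by norm_num, ?_⟩
  intro O A S _ _ _ _ _ ν _ M φ H hH β _ f hf C α hα hocc hcov P c hP ε hε hex N hN δ hδ hδ1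
  obtain ⟨π₀, hπ₀, hloss⟩ := hex
  have := RCSL.stateLaw_prob M φ hH β
  obtain ⟨s₀⟩ : Nonempty S := nonempty_of_isProbabilityMeasure (RCSL.stateLaw M φ H β)
  obtain ⟨a₀⟩ := ‹Nonempty A›
  have hc : 0 ≤ c := (abs_nonneg _).trans ((hP π₀ hπ₀).2 s₀ 0 a₀ s₀ 0 a₀)
  have hN0 : (0 : ℝ) < N := by exact_mod_cast hN
  have hH0 : (0 : ℝ) < H := by exact_mod_cast hH
  have hcard : (1 : ℝ) ≤ P.card := by exact_mod_cast Finset.card_pos.2 ⟨π₀, hπ₀⟩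
  set L := Real.log ((P.card : ℝ) / δ) / (N : ℝ) with hL
  have hL0 : 0 ≤ L := div_nonneg
    (Real.log_nonneg ((one_le_div hδ).2 (by linarith))) hN0.le
  set u := 4 * c * √L with hu
  have hu0 : 0 ≤ u := by positivity
  -- Steps of one trajectory are dependent, so the log-ratio is averaged over each trajectory and
  -- only whole trajectories are treated as independent.
  set X : RCSL.RCPolicy S ν → RCSL.Traj O A H → ℝ := fun π τ => (H : ℝ)⁻¹ * ∑ t,
    RCSL.logRatio π₀ π ((RCSL.stateAt φ τ t, RCSL.ret τ), RCSL.actionAt τ t) with hX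
  have hXm : ∀ π, Measurable (X π) := fun π => by
    refine measurable_const.mul (Finset.measurable_sum _ fun t _ => ?_)
    have hm : Measurable fun x : RCSL.Traj O A H × Fin H =>
        ((RCSL.stateAt φ x.1 x.2, RCSL.ret x.1), RCSL.actionAt x.1 x.2) :=
      (RCSL.measurable_stateAt_ret φ).prodMk RCSL.measurable_actionAt
    exact (RCSL.measurable_logRatio π₀ π).comp (hm.comp measurable_prodMk_right)
  set ρ := Measure.pi (fun _ : Fin N => RCSL.trajLaw M φ H β) with hρ
  -- The log-ratio itself has no bound in terms of `c`, only its variation: `c` from each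
  -- likelihood. Hence the range `4 * c` in Hoeffding's inequality and in `u`.
  have hr : ∀ π ∈ P, ∀ x, |RCSL.logRatio π₀ π x - RCSL.logRatio π₀ π ((s₀, 0), a₀)| ≤ 2 * c := by
    intro π hπ x
    have h1 := abs_le.1 ((hP π hπ).2 x.1.1 x.1.2 x.2 s₀ 0 a₀)
    have h2 := abs_le.1 ((hP π₀ hπ₀).2 x.1.1 x.1.2 x.2 s₀ 0 a₀)
    simp only [RCSL.logRatio]
    rw [abs_le]
    constructor <;> linarith
  have hbad : ∀ π ∈ P, u < ∫ τ, X π τ ∂(RCSL.trajLaw M φ H β) →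
      ρ {D | ∑ i, X π (D i) ≤ 0} ≤ ENNReal.ofReal (δ / P.card) := by
    intro π hπ hm
    refine measure_pi_sum_nonpos_le _ (hXm π) (a := RCSL.logRatio π₀ π ((s₀, 0), a₀) - 2 * c)
      (w := 4 * c) (by positivity) (fun τ => ?_) hN (by positivity) (by rwa [one_div_div])
    have h1 : ∀ x, RCSL.logRatio π₀ π ((s₀, 0), a₀) - 2 * c ≤ RCSL.logRatio π₀ π x := fun x => by
      linarith [abs_le.1 (hr π hπ x)]
    have h2 : ∀ x, RCSL.logRatio π₀ π x ≤ RCSL.logRatio π₀ π ((s₀, 0), a₀) - 2 * c + 4 * c :=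
      fun x => by linarith [abs_le.1 (hr π hπ x)]
    simp only [hX]
    constructor
    · rw [← div_eq_inv_mul, le_div_iff₀ hH0, mul_comm]
      simpa using Finset.card_nsmul_le_sum Finset.univ _ _ fun (t : Fin H) _ =>
        h1 ((RCSL.stateAt φ τ t, RCSL.ret τ), RCSL.actionAt τ t)
    · rw [← div_eq_inv_mul, div_le_iff₀ hH0, mul_comm _ (H : ℝ)]
      simpa [-smul_add, mul_add] using Finset.sum_le_card_nsmul Finset.univ _ _ fun (t : Fin H) _ =>
        h2 ((RCSL.stateAt φ τ t, RCSL.ret τ), RCSL.actionAt τ t)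
  set E := {D : Fin N → RCSL.Traj O A H | ∀ π, RCSL.IsEmpMinimizer φ D P π →
    RCSL.J M φ H (RCSL.rcslPolicy M φ H β f hf) -
      RCSL.J M φ H (RCSL.conditionOn π.toKernel f hf) ≤
      4 * (C / α * (H : ℝ) ^ 2 * (√c * L ^ (1 / 4 : ℝ) + √ε))} with hE
  -- Failure needs a minimizer with large true mean and nonpositive empirical sum. The condition on
  -- the mean does not involve `D`, so each set is empty or a Hoeffding event.
  have hsub : Eᶜ ⊆ ⋃ π ∈ P, {D | u < ∫ τ, X π τ ∂(RCSL.trajLaw M φ H β) ∧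
      ∑ i, X π (D i) ≤ 0} := by
    intro D hD
    by_contra hD'
    refine hD fun π hπ => ?_
    have hsum : ∑ i, X π (D i) ≤ 0 := by
      have h1 : ∑ i, X π (D i) = (H : ℝ)⁻¹ * (RCSL.empLoss φ D π - RCSL.empLoss φ D π₀) := by
        simp only [hX, RCSL.logRatio, RCSL.empLoss, ← Finset.mul_sum, Finset.sum_sub_distrib]
        ring
      rw [h1]
      exact mul_nonpos_of_nonneg_of_nonpos (by positivity) (by linarith [hπ.2 π₀ hπ₀])
    have hmean : ∫ τ, X π τ ∂(RCSL.trajLaw M φ H β) ≤ u := by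
      by_contra! hm
      exact hD' (Set.mem_iUnion₂.2 ⟨π, hπ.1, hm, hsum⟩)
    have hl := RCSL.loss_le M φ hH β π₀ π (hP π₀ hπ₀).1 (hP π hπ.1).1
      (b := |RCSL.logRatio π₀ π ((s₀, 0), a₀)| + 2 * c) (fun x => by
        have h1 := abs_add_le (RCSL.logRatio π₀ π x - RCSL.logRatio π₀ π ((s₀, 0), a₀))
          (RCSL.logRatio π₀ π ((s₀, 0), a₀))
        rw [sub_add_cancel] at h1
        linarith [hr π hπ.1 x]) hε hloss
    have hl' : RCSL.loss M φ H β π ≤ ENNReal.ofReal (ε + u) :=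
      hl.trans (ENNReal.ofReal_le_ofReal (by gcongr))
    have hJ := RCSL.J_rcslPolicy_le M φ hH β hf hα hocc hcov π (by positivity) hl'
    have hC := RCSL.occupancy_const_nonneg M φ hH β hf hocc
    have hsq : 2 * √(ε + u) ≤ 4 * (√c * L ^ (1 / 4 : ℝ) + √ε) := by
      have h1 : √u = 2 * (√c * L ^ (1 / 4 : ℝ)) := by
        have h4 : √(4 : ℝ) = 2 := by
          rw [show (4 : ℝ) = 2 ^ 2 by norm_num, Real.sqrt_sq (by norm_num)]
        rw [hu, Real.sqrt_mul (by positivity), Real.sqrt_mul (by norm_num), h4, mul_assoc,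
          Real.sqrt_eq_rpow √L, Real.sqrt_eq_rpow L, ← Real.rpow_mul hL0]
        norm_num
      have h2 : √(ε + u) ≤ √ε + √u := by
        refine Real.sqrt_le_iff.2 ⟨by positivity, ?_⟩
        nlinarith [Real.sq_sqrt hε, Real.sq_sqrt hu0, Real.sqrt_nonneg ε, Real.sqrt_nonneg u,
          mul_nonneg (Real.sqrt_nonneg ε) (Real.sqrt_nonneg u)]
      rw [h1] at h2
      linarith [Real.sqrt_nonneg ε]
    calc _ ≤ _ := hJ
      _ ≤ C / α * (H : ℝ) ^ 2 * (4 * (√c * L ^ (1 / 4 : ℝ) + √ε)) := by gcongr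
      _ = _ := by ring
  have hEc : ρ Eᶜ ≤ ENNReal.ofReal δ := by
    refine (measure_mono hsub).trans ((measure_biUnion_finset_le _ _).trans ?_)
    calc ∑ π ∈ P, ρ {D | u < ∫ τ, X π τ ∂(RCSL.trajLaw M φ H β) ∧ ∑ i, X π (D i) ≤ 0}
        ≤ ∑ _π ∈ P, ENNReal.ofReal (δ / P.card) := by
          refine Finset.sum_le_sum fun π hπ => ?_
          by_cases hm : u < ∫ τ, X π τ ∂(RCSL.trajLaw M φ H β)
          · exact (measure_mono fun D hD => hD.2).trans (hbad π hπ hm)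
          · simp [hm]
      _ = ENNReal.ofReal δ := by
          rw [Finset.sum_const, nsmul_eq_mul, ← ENNReal.ofReal_natCast,
            ← ENNReal.ofReal_mul (by positivity), mul_div_cancel₀ _ (by positivity)]
  -- Subadditivity suffices here, so measurability of `E` is not needed.
  have h1 : 1 ≤ ρ E + ENNReal.ofReal δ := by
    rw [← measure_univ (μ := ρ), ← Set.union_compl_self E]
    exact (measure_union_le _ _).trans (add_le_add le_rfl hEc)
  rw [ENNReal.ofReal_sub _ hδ.le, ENNReal.ofReal_one]
  exact tsub_le_iff_right.2 h1
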